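/- Let $p\in[1,\infty)$ and $d\in\mathbb N$. Write points of $\mathbb R^{d+1}$ as $z=(x,t)$ with $x\in\mathbb R^d$ and $t\in\mathbb R$ (the last coordinate), and let $\|u\|_p=\big(\sum_i|u_i|^p\big)^{1/p}$ and $d_p(z,z')=\|z-z'\|_p$. Let $P(\mathbb R^{d+1})$ be the set of Borel probability measures on $\mathbb R^{d+1}$, and let $$P_p(\mathbb R^{d+1})=\Big\{\mu\in P(\mathbb R^{d+1}) : \int d_p(z_0,z)^p\,d\mu(z)<\infty\Big\},$$ where $z_0\in\mathbb R^{d+1}$ is arbitrary (the condition does not depend on $z_0$). For $w\in[0,1]$ put $$d_{p,w}\big((x,t),(y,s)\big)=\big(w\|x-y\|_p^p+(1-w)|t-s|^p\big)^{1/p}.$$ For $\alpha,\beta\in P(\mathbb R^{d+1})$ let $\Pi(\alpha,\beta)$ be the set of probability measures on $\mathbb R^{d+1}\times\mathbb R^{d+1}$ with marginals $\alpha$ and $\beta$, and define $$\mathcal D_p(\alpha,\beta)=\sup_{w\in[0,1]}\Big[\inf_{\pi\in\Pi(\alpha,\beta)}\int d_{p,w}(z,z')^p\,d\pi(z,z')\Big]^{1/p}\in[0,\infty].$$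 Let $(\mu_k)_{k\in\mathbb N}$ be a sequence in $P_p(\mathbb R^{d+1})$ and let $\mu\in P(\mathbb R^{d+1})$. Then the following two statements are equivalent: (i) $\mu_k$ converges weakly in $P_p(\mathbb R^{d+1})$ to $\mu$, that is, $\mu\in P_p(\mathbb R^{d+1})$, and for every bounded continuous function $\phi:\mathbb R^{d+1}\to\mathbb R$ and every $z_0\in\mathbb R^{d+1}$, $$\int\phi\,d\mu_k\to\int\phi\,d\mu\quad\text{and}\quad\int d_p(z_0,z)^p\,d\mu_k(z)\to\int d_p(z_0,z)^p\,d\mu(z);$$ (ii) $\mathcal D_p(\mu_k,\mu)\to0$. -/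

import Mathlib

open MeasureTheory Filter Topology
open scoped ENNReal BoundedContinuousFunction

noncomputable section

namespace TiOT

/-- The `ℓ^p` distance `‖x - y‖_p = (∑ i, |x i - y i| ^ p) ^ (1 / p)` on `ℝ^n`. -/
def lpDist (p : ℝ) {n : ℕ} (x y : Fin n → ℝ) : ℝ :=
  (∑ i, |x i - y i| ^ p) ^ (1 / p)

/-- The feature part `x ∈ ℝ^d` of a point `z = (x, t)` of `ℝ^(d+1)`. -/
def feature {d : ℕ} (z : Fin (d + 1) → ℝ) : Fin d → ℝ := fun i => z i.castSucc

/-- The time `t`, i.e. the last coordinate, of a point `z = (x, t)` of `ℝ^(d+1)`. -/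
def time {d : ℕ} (z : Fin (d + 1) → ℝ) : ℝ := z (Fin.last d)

/-- `d_{p,w}((x,t),(y,s)) = (w ‖x - y‖_p ^ p + (1 - w) |t - s| ^ p) ^ (1 / p)`. -/
def weightedDist (p w : ℝ) {d : ℕ} (z z' : Fin (d + 1) → ℝ) : ℝ :=
  (w * lpDist p (feature z) (feature z') ^ p + (1 - w) * |time z - time z'| ^ p) ^ (1 / p)

/-- The set `P_p(ℝ^n)` of Borel probability measures with finite `p`-th moment. -/
def FiniteMoment (p : ℝ) (n : ℕ) : Set (ProbabilityMeasure (Fin n → ℝ)) :=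
  {μ | ∀ z₀ : Fin n → ℝ,
    ∫⁻ z, ENNReal.ofReal (lpDist p z₀ z ^ p) ∂(μ : Measure (Fin n → ℝ)) < ∞}

/-- The set `Π(α, β)` of couplings: probability measures on the product with marginals
`α` and `β`. -/
def Couplings {n : ℕ} (α β : ProbabilityMeasure (Fin n → ℝ)) :
    Set (ProbabilityMeasure ((Fin n → ℝ) × (Fin n → ℝ))) :=
  {π | (∀ A : Set (Fin n → ℝ), MeasurableSet A →
          (π : Measure ((Fin n → ℝ) × (Fin n → ℝ))) (A ×ˢ Set.univ) = (α : Measure _) A) ∧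
       (∀ B : Set (Fin n → ℝ), MeasurableSet B →
          (π : Measure ((Fin n → ℝ) × (Fin n → ℝ))) (Set.univ ×ˢ B) = (β : Measure _) B)}

/-- The transport distance `W_{p,w}(α, β)` of order `p` for the cost `d_{p,w} ^ p`, with values
in `[0, ∞]` (it is finite on measures with finite `p`-th moment). -/
def weightedWasserstein (p w : ℝ) {d : ℕ} (α β : ProbabilityMeasure (Fin (d + 1) → ℝ)) : ℝ≥0∞ :=
  (⨅ π ∈ Couplings α β,
    ∫⁻ q, ENNReal.ofReal (weightedDist p w q.1 q.2 ^ p)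
      ∂(π : Measure ((Fin (d + 1) → ℝ) × (Fin (d + 1) → ℝ)))) ^ (1 / p)

/-- The time-integrated optimal transport distance
`D_p(α, β) = max_{w ∈ [0,1]} W_{p,w}(α, β)`. -/
def tiotDist (p : ℝ) {d : ℕ} (α β : ProbabilityMeasure (Fin (d + 1) → ℝ)) : ℝ≥0∞ :=
  ⨆ w ∈ Set.Icc (0 : ℝ) 1, weightedWasserstein p w α β

/-- Weak convergence in `P_p(ℝ^n)` of a sequence to `μ`: all measures belong to `P_p(ℝ^n)`,
integrals of bounded continuous functions converge, and so do the `p`-th moments about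
every point. -/
structure WeaklyConvergesInPp (p : ℝ) {n : ℕ} (μs : ℕ → ProbabilityMeasure (Fin n → ℝ))
    (μ : ProbabilityMeasure (Fin n → ℝ)) : Prop where
  mem_seq : ∀ k, μs k ∈ FiniteMoment p n
  mem_limit : μ ∈ FiniteMoment p n
  tendsto_integral : ∀ φ : (Fin n → ℝ) →ᵇ ℝ,
    Tendsto (fun k => ∫ z, φ z ∂(μs k : Measure (Fin n → ℝ))) atTop
      (𝓝 (∫ z, φ z ∂(μ : Measure (Fin n → ℝ))))
  tendsto_moment : ∀ z₀ : Fin n → ℝ,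
    Tendsto (fun k => ∫ z, lpDist p z₀ z ^ p ∂(μs k : Measure (Fin n → ℝ))) atTop
      (𝓝 (∫ z, lpDist p z₀ z ^ p ∂(μ : Measure (Fin n → ℝ))))

end TiOT

end

/-! Every weighted cost `d_{p,w} ^ p` is at most `‖z - z'‖_p ^ p`, and for `w = 1/2` it is exactly
half of it. Hence `D_p` tends to zero exactly when the unweighted cost `transportCost` does
(`tendsto_tiotDist_iff`). What remains is the classical description of Wasserstein convergence.

If the costs vanish, nearly optimal couplings control bounded Lipschitz test functions, which
determine weak convergence (`edist_integral_le_of_coupling`), and Minkowski's inequality controls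
the moments coordinate by coordinate (`tendsto_lintegral_coordinate`).

Conversely, couplings are built by hand. Outside a compact set `K` the limit has little `p`-th
moment; cover `K` by finitely many small balls and take a subordinate, compactly supported partition
of unity. Match as much mass as possible inside each member, at small cost, and couple the rest
independently, at a cost bounded by the moments of the leftovers (`exists_coupling_lintegral_le`).
Those moments converge, since the total moments and the compactly supported parts do, and their
limit is small because the partition sums to one on `K`. -/

namespace TiOT

/-! ### Couplings that match mass locally -/

section Coupling

variable {E : Type*} [MeasurableSpace E]

/-- The product of two finite measures of equal mass, normalized so that its marginals are the
two measures. -/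
noncomputable def normalizedProd (α β : Measure E) : Measure (E × E) :=
  (α Set.univ)⁻¹ • α.prod β

theorem map_fst_normalizedProd (α β : Measure E) [IsFiniteMeasure α] [IsFiniteMeasure β]
    (h : α Set.univ = β Set.univ) : (normalizedProd α β).map Prod.fst = α := by
  rw [normalizedProd, Measure.map_smul, Measure.map_fst_prod, smul_smul, ← h]
  -- At zero mass the normalizing factor is `∞`, but the measure it scales is zero.
  rcases eq_or_ne (α Set.univ) 0 with h0 | h0
  · rw [Measure.measure_univ_eq_zero.1 h0, smul_zero]
  · rw [ENNReal.inv_mul_cancel h0 (measure_ne_top _ _), one_smul]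

theorem map_snd_normalizedProd (α β : Measure E) [IsFiniteMeasure α] [IsFiniteMeasure β]
    (h : α Set.univ = β Set.univ) : (normalizedProd α β).map Prod.snd = β := by
  rw [normalizedProd, Measure.map_smul, Measure.map_snd_prod, smul_smul, h]
  rcases eq_or_ne (β Set.univ) 0 with h0 | h0
  · rw [Measure.measure_univ_eq_zero.1 h0, smul_zero]
  · rw [ENNReal.inv_mul_cancel h0 (measure_ne_top _ _), one_smul]

/-- The proportion of a mass `a` that can be matched with a mass `b`. -/
noncomputable def matchRatio (a b : ℝ≥0∞) : ℝ≥0∞ := min a b / a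

theorem matchRatio_le_one (a b : ℝ≥0∞) : matchRatio a b ≤ 1 :=
  ENNReal.div_le_of_le_mul (by simp)

theorem matchRatio_mul {a : ℝ≥0∞} (ha : a ≠ ∞) (b : ℝ≥0∞) : matchRatio a b * a = min a b := by
  rcases eq_or_ne a 0 with rfl | h0
  · simp
  · exact ENNReal.div_mul_cancel h0 ha

/-- The ratio tends to one unless the limiting mass `a₀` is zero. In that case it may oscillate, but
it stays below one and `h0` makes the other factor vanish. -/
theorem tendsto_matchRatio_mul {a b n : ℕ → ℝ≥0∞} {a₀ n₀ : ℝ≥0∞} (ha : Tendsto a atTop (𝓝 a₀))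
    (hb : Tendsto b atTop (𝓝 a₀)) (hn : Tendsto n atTop (𝓝 n₀)) (ha₀ : a₀ ≠ ∞)
    (h0 : a₀ = 0 → n₀ = 0) :
    Tendsto (fun k => matchRatio (a k) (b k) * n k) atTop (𝓝 n₀) := by
  rcases eq_or_ne a₀ 0 with h | h
  · rw [h0 h] at hn ⊢
    refine tendsto_of_tendsto_of_tendsto_of_le_of_le tendsto_const_nhds hn (fun _ => zero_le) ?_
    exact fun k => mul_le_of_le_one_left' (matchRatio_le_one _ _)
  · have hr : Tendsto (fun k => matchRatio (a k) (b k)) atTop (𝓝 1) := by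
      have := ENNReal.Tendsto.div (ha.min hb) (Or.inr h) ha (Or.inr (by simpa using ha₀))
      rwa [min_self, ENNReal.div_self h ha₀] at this
    simpa using ENNReal.Tendsto.mul hr (Or.inl one_ne_zero) hn (Or.inr ENNReal.one_ne_top)

variable {ι : Type*} [Fintype ι]

/-- The density left over after the fractions `r i` of the densities `f i` have been removed. -/
noncomputable def residual {E : Type*} (f : ι → E → ℝ≥0∞) (r : ι → ℝ≥0∞) (z : E) : ℝ≥0∞ :=
  1 - ∑ i, r i * f i z

theorem measurable_residual {f : ι → E → ℝ≥0∞} (hf : ∀ i, Measurable (f i)) (r : ι → ℝ≥0∞) :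
    Measurable (residual f r) := by
  unfold residual
  fun_prop

theorem residual_add {E : Type*} {f : ι → E → ℝ≥0∞} (hsum : ∀ z, ∑ i, f i z ≤ 1) {r : ι → ℝ≥0∞}
    (hr : ∀ i, r i ≤ 1) (z : E) : residual f r z + ∑ i, r i * f i z = 1 :=
  tsub_add_cancel_of_le <|
    (Finset.sum_le_sum fun i _ => mul_le_of_le_one_left' (hr i)).trans (hsum z)

theorem lintegral_mul_residual_add {f : ι → E → ℝ≥0∞} (hf : ∀ i, Measurable (f i))
    (hsum : ∀ z, ∑ i, f i z ≤ 1) {r : ι → ℝ≥0∞} (hr : ∀ i, r i ≤ 1) {N : E → ℝ≥0∞}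
    (hN : Measurable N) (ν : Measure E) :
    ∫⁻ z, residual f r z * N z ∂ν + ∑ i, r i * ∫⁻ z, f i z * N z ∂ν = ∫⁻ z, N z ∂ν := by
  have hm := measurable_residual hf r
  have h1 : ∀ i, r i * ∫⁻ z, f i z * N z ∂ν = ∫⁻ z, r i * (f i z * N z) ∂ν := fun i =>
    (lintegral_const_mul _ (by fun_prop)).symm
  simp_rw [h1]
  rw [← lintegral_finsetSum _ (by fun_prop), ← lintegral_add_left (by fun_prop)]
  refine lintegral_congr fun z => ?_
  simp_rw [← mul_assoc]
  rw [← Finset.sum_mul, ← add_mul, residual_add hsum hr, one_mul]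

/-- The residual is handled by subtraction: the full integral of `N` and the removed parts both
converge to finite limits. This is where convergence of moments rules out mass escaping to infinity.
-/
theorem tendsto_lintegral_mul_residual {f : ι → E → ℝ≥0∞} (hf : ∀ i, Measurable (f i))
    (hsum : ∀ z, ∑ i, f i z ≤ 1) {N : E → ℝ≥0∞} (hN : Measurable N)
    {r : ℕ → ι → ℝ≥0∞} (hr : ∀ k i, r k i ≤ 1) {ν : ℕ → Measure E} {μ : Measure E}
    (hfin : ∫⁻ z, N z ∂μ ≠ ∞)
    (h : Tendsto (fun k => ∫⁻ z, N z ∂(ν k)) atTop (𝓝 (∫⁻ z, N z ∂μ)))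
    (hi : ∀ i, Tendsto (fun k => r k i * ∫⁻ z, f i z * N z ∂(ν k)) atTop
      (𝓝 (∫⁻ z, f i z * N z ∂μ))) :
    Tendsto (fun k => ∫⁻ z, residual f (r k) z * N z ∂(ν k)) atTop
      (𝓝 (∫⁻ z, residual f 1 z * N z ∂μ)) := by
  have hsumlim := tendsto_finsetSum Finset.univ fun i _ => hi i
  have key : ∫⁻ z, residual f 1 z * N z ∂μ + ∑ i, ∫⁻ z, f i z * N z ∂μ = ∫⁻ z, N z ∂μ := by
    simpa using lintegral_mul_residual_add hf hsum (r := 1) (fun _ => le_rfl) hN μ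
  have hne : ∑ i, ∫⁻ z, f i z * N z ∂μ ≠ ∞ :=
    ne_top_of_le_ne_top hfin (key ▸ le_add_self)
  rw [ENNReal.eq_sub_of_add_eq hne key]
  refine (ENNReal.Tendsto.sub h hsumlim (Or.inl hfin)).congr' ?_
  filter_upwards [hsumlim.eventually_lt_const hne.lt_top] with k hk
  exact (ENNReal.eq_sub_of_add_eq hk.ne (lintegral_mul_residual_add hf hsum (hr k) hN _)).symm

theorem sum_withDensity_add_residual {f : ι → E → ℝ≥0∞} (hf : ∀ i, Measurable (f i))
    (hsum : ∀ z, ∑ i, f i z ≤ 1) {r : ι → ℝ≥0∞} (hr : ∀ i, r i ≤ 1) (ν : Measure E) :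
    ∑ i, ν.withDensity (fun z => r i * f i z) + ν.withDensity (residual f r) = ν := by
  ext s hs
  have := lintegral_mul_residual_add hf hsum hr (N := fun _ => 1) measurable_const (ν.restrict s)
  simp only [mul_one, lintegral_one, Measure.restrict_apply_univ] at this
  rw [Measure.add_apply, Measure.finsetSum_apply, withDensity_apply _ hs, add_comm]
  simp_rw [withDensity_apply _ hs]
  rw [← this]
  congr 1
  exact Finset.sum_congr rfl fun i _ => lintegral_const_mul _ (hf i)

/-- Two probability measures can be coupled by matching as much mass as possible inside each
member of a family of densities, and the left over mass independently. -/
theorem exists_coupling_lintegral_le {f : ι → E → ℝ≥0∞} (hf : ∀ i, Measurable (f i))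
    (hsum : ∀ z, ∑ i, f i z ≤ 1) {N : E → ℝ≥0∞} (hN : Measurable N) {c : E × E → ℝ≥0∞}
    {δ C : ℝ≥0∞} (hδ : ∀ i z z', f i z ≠ 0 → f i z' ≠ 0 → c (z, z') ≤ δ)
    (hC : ∀ z z', c (z, z') ≤ C * (N z + N z'))
    (α β : Measure E) [IsProbabilityMeasure α] [IsProbabilityMeasure β] :
    ∃ π : Measure (E × E), π.map Prod.fst = α ∧ π.map Prod.snd = β ∧
      ∫⁻ q, c q ∂π ≤ δ +
        C * (∫⁻ z, residual f (fun i => matchRatio (∫⁻ z, f i z ∂α) (∫⁻ z, f i z ∂β)) z * N z ∂α +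
          ∫⁻ z, residual f (fun i => matchRatio (∫⁻ z, f i z ∂β) (∫⁻ z, f i z ∂α)) z * N z ∂β) := by
  set r : ι → ℝ≥0∞ := fun i => matchRatio (∫⁻ z, f i z ∂α) (∫⁻ z, f i z ∂β)
  set s : ι → ℝ≥0∞ := fun i => matchRatio (∫⁻ z, f i z ∂β) (∫⁻ z, f i z ∂α)
  have hr : ∀ i, r i ≤ 1 := fun i => matchRatio_le_one _ _
  have hs : ∀ i, s i ≤ 1 := fun i => matchRatio_le_one _ _
  have hfle : ∀ i z, f i z ≤ 1 := fun i z =>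
    (Finset.single_le_sum (f := fun i => f i z) (fun _ _ => zero_le) (Finset.mem_univ i)).trans
      (hsum z)
  have hfin : ∀ (ν : Measure E) [IsProbabilityMeasure ν] (i : ι), ∫⁻ z, f i z ∂ν ≠ ∞ :=
    fun ν _ i => ne_top_of_le_ne_top ENNReal.one_ne_top
      ((lintegral_mono (hfle i)).trans (by simp))
  have hα := sum_withDensity_add_residual hf hsum hr α
  have hβ := sum_withDensity_add_residual hf hsum hs β
  set α' : ι → Measure E := fun i => α.withDensity (fun z => r i * f i z)
  set β' : ι → Measure E := fun i => β.withDensity (fun z => s i * f i z)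
  set αr := α.withDensity (residual f r)
  set βr := β.withDensity (residual f s)
  have hα'le : ∀ i, α' i ≤ α := fun i => by
    conv_rhs => rw [← hα]
    exact (Finset.single_le_sum (f := α') (fun _ _ => Measure.zero_le _) (Finset.mem_univ i)).trans
      (Measure.le_add_right le_rfl)
  have hβ'le : ∀ i, β' i ≤ β := fun i => by
    conv_rhs => rw [← hβ]
    exact (Finset.single_le_sum (f := β') (fun _ _ => Measure.zero_le _) (Finset.mem_univ i)).trans
      (Measure.le_add_right le_rfl)
  have : ∀ i, IsFiniteMeasure (α' i) := fun i => isFiniteMeasure_of_le α (hα'le i)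
  have : ∀ i, IsFiniteMeasure (β' i) := fun i => isFiniteMeasure_of_le β (hβ'le i)
  have : IsFiniteMeasure αr :=
    isFiniteMeasure_of_le α (by conv_rhs => rw [← hα]
                                exact Measure.le_add_left le_rfl)
  have : IsFiniteMeasure βr :=
    isFiniteMeasure_of_le β (by conv_rhs => rw [← hβ]
                                exact Measure.le_add_left le_rfl)
  -- Both sides equal the minimum of the two masses that `α` and `β` give to `f i`.
  have hmass : ∀ i, α' i Set.univ = β' i Set.univ := fun i => by
    simp only [α', β', withDensity_apply _ MeasurableSet.univ, Measure.restrict_univ]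
    rw [lintegral_const_mul _ (hf i), lintegral_const_mul _ (hf i), matchRatio_mul (hfin α i),
      matchRatio_mul (hfin β i), min_comm]
  have hαu : ∑ i, α' i Set.univ + αr Set.univ = 1 := by
    rw [← Measure.finsetSum_apply, ← Measure.add_apply, hα, measure_univ]
  have hβu : ∑ i, β' i Set.univ + βr Set.univ = 1 := by
    rw [← Measure.finsetSum_apply, ← Measure.add_apply, hβ, measure_univ]
  have hmassr : αr Set.univ = βr Set.univ := by
    have hne : ∑ i, α' i Set.univ ≠ ∞ :=
      ne_top_of_le_ne_top ENNReal.one_ne_top (hαu ▸ le_self_add)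
    refine (ENNReal.add_right_inj hne).1 ?_
    rw [hαu, ← hβu]
    simp_rw [hmass]
  set π' : ι → Measure (E × E) := fun i => normalizedProd (α' i) (β' i)
  set πr := normalizedProd αr βr
  have hf1 : ∀ i, (π' i).map Prod.fst = α' i := fun i => map_fst_normalizedProd _ _ (hmass i)
  have hf2 : ∀ i, (π' i).map Prod.snd = β' i := fun i => map_snd_normalizedProd _ _ (hmass i)
  have hr1 : πr.map Prod.fst = αr := map_fst_normalizedProd _ _ hmassr
  have hr2 : πr.map Prod.snd = βr := map_snd_normalizedProd _ _ hmassr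
  refine ⟨∑ i, π' i + πr, ?_, ?_, ?_⟩
  · rw [Measure.map_add _ _ measurable_fst, hr1, ← Measure.mapₗ_apply_of_measurable measurable_fst,
      map_sum]
    simp_rw [Measure.mapₗ_apply_of_measurable measurable_fst, hf1]
    exact hα
  · rw [Measure.map_add _ _ measurable_snd, hr2, ← Measure.mapₗ_apply_of_measurable measurable_snd,
      map_sum]
    simp_rw [Measure.mapₗ_apply_of_measurable measurable_snd, hf2]
    exact hβ
  · rw [lintegral_add_measure, lintegral_finsetSum_measure]
    refine add_le_add ?_ ?_
    · have hle : ∀ i, ∫⁻ q, c q ∂(π' i) ≤ δ * α' i Set.univ := fun i => by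
        -- The marginals of `π' i` have densities proportional to `f i`, so almost every pair lies
        -- where `hδ` applies.
        have e1 : ∀ᵐ q ∂(π' i), f i q.1 ≠ 0 := by
          refine ae_of_ae_map (μ := π' i) (p := fun z => f i z ≠ 0)
            measurable_fst.aemeasurable ?_
          rw [hf1, ae_withDensity_iff (by fun_prop)]
          exact ae_of_all _ fun z hz h => hz (by rw [h, mul_zero])
        have e2 : ∀ᵐ q ∂(π' i), f i q.2 ≠ 0 := by
          refine ae_of_ae_map (μ := π' i) (p := fun z => f i z ≠ 0)
            measurable_snd.aemeasurable ?_
          rw [hf2, ae_withDensity_iff (by fun_prop)]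
          exact ae_of_all _ fun z hz h => hz (by rw [h, mul_zero])
        calc ∫⁻ q, c q ∂(π' i) ≤ ∫⁻ _, δ ∂(π' i) := by
              refine lintegral_mono_ae ?_
              filter_upwards [e1, e2] with q h1 h2 using hδ i q.1 q.2 h1 h2
          _ = δ * α' i Set.univ := by
              rw [lintegral_const, ← hf1 i, Measure.map_apply measurable_fst MeasurableSet.univ,
                Set.preimage_univ]
      refine (Finset.sum_le_sum fun i _ => hle i).trans ?_
      rw [← Finset.mul_sum]
      exact mul_le_of_le_one_right' (hαu ▸ le_self_add)
    · calc ∫⁻ q, c q ∂πr ≤ ∫⁻ q, C * (N q.1 + N q.2) ∂πr := lintegral_mono fun q => hC q.1 q.2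
        _ = C * (∫⁻ z, N z ∂αr + ∫⁻ z, N z ∂βr) := by
            rw [lintegral_const_mul _ (by fun_prop), lintegral_add_left (by fun_prop), ← hr1,
              ← hr2, lintegral_map hN measurable_fst, lintegral_map hN measurable_snd]
        _ = _ := by
            rw [lintegral_withDensity_eq_lintegral_mul _ (measurable_residual hf r) hN,
              lintegral_withDensity_eq_lintegral_mul _ (measurable_residual hf s) hN]
            rfl

/-- Couplings of small cost exist eventually along a sequence whose integrals against the
members of a family of densities converge. -/
theorem eventually_exists_coupling_lintegral_le {f : ι → E → ℝ≥0∞} (hf : ∀ i, Measurable (f i))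
    (hsum : ∀ z, ∑ i, f i z ≤ 1) {N : E → ℝ≥0∞} (hN : Measurable N) {c : E × E → ℝ≥0∞}
    {δ C η : ℝ≥0∞} (hδ : ∀ i z z', f i z ≠ 0 → f i z' ≠ 0 → c (z, z') ≤ δ)
    (hC : ∀ z z', c (z, z') ≤ C * (N z + N z')) {ν : ℕ → Measure E} {μ : Measure E}
    [∀ k, IsProbabilityMeasure (ν k)] [IsProbabilityMeasure μ]
    (hfin : ∫⁻ z, N z ∂μ ≠ ∞)
    (h : Tendsto (fun k => ∫⁻ z, N z ∂(ν k)) atTop (𝓝 (∫⁻ z, N z ∂μ)))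
    (hi : ∀ i, Tendsto (fun k => ∫⁻ z, f i z ∂(ν k)) atTop (𝓝 (∫⁻ z, f i z ∂μ)))
    (hiN : ∀ i, Tendsto (fun k => ∫⁻ z, f i z * N z ∂(ν k)) atTop (𝓝 (∫⁻ z, f i z * N z ∂μ)))
    (hη : ∫⁻ z, residual f 1 z * N z ∂μ < η) :
    ∀ᶠ k in atTop, ∃ π : Measure (E × E), π.map Prod.fst = ν k ∧ π.map Prod.snd = μ ∧
      ∫⁻ q, c q ∂π ≤ δ + C * (η + η) := by
  have hfle : ∀ i z, f i z ≤ 1 := fun i z =>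
    (Finset.single_le_sum (f := fun i => f i z) (fun _ _ => zero_le) (Finset.mem_univ i)).trans
      (hsum z)
  have hfi : ∀ i, ∫⁻ z, f i z ∂μ ≠ ∞ := fun i => ne_top_of_le_ne_top ENNReal.one_ne_top
      ((lintegral_mono (hfle i)).trans (by simp))
  have h0 : ∀ i, ∫⁻ z, f i z ∂μ = 0 → ∫⁻ z, f i z * N z ∂μ = 0 := fun i hz => by
    rw [lintegral_eq_zero_iff (hf i)] at hz
    refine (lintegral_eq_zero_iff ((hf i).mul hN)).2 ?_
    filter_upwards [hz] with z hz
    simp_all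
  have t1 := tendsto_lintegral_mul_residual hf hsum hN
    (r := fun k i => matchRatio (∫⁻ z, f i z ∂(ν k)) (∫⁻ z, f i z ∂μ))
    (fun _ _ => matchRatio_le_one _ _) hfin h
    (fun i => tendsto_matchRatio_mul (hi i) tendsto_const_nhds (hiN i) (hfi i) (h0 i))
  -- On the side of `μ` the measure is fixed, but its residual still depends on `k` through the
  -- ratios.
  have t2 := tendsto_lintegral_mul_residual hf hsum hN
    (r := fun k i => matchRatio (∫⁻ z, f i z ∂μ) (∫⁻ z, f i z ∂(ν k)))
    (fun _ _ => matchRatio_le_one _ _) hfin (ν := fun _ => μ) tendsto_const_nhds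
    (fun i => tendsto_matchRatio_mul tendsto_const_nhds (hi i) tendsto_const_nhds (hfi i) (h0 i))
  filter_upwards [t1.eventually_lt_const hη, t2.eventually_lt_const hη] with k h1 h2
  obtain ⟨π, hπ1, hπ2, hπ⟩ := exists_coupling_lintegral_le hf hsum hN hδ hC (ν k) μ
  exact ⟨π, hπ1, hπ2, hπ.trans (by gcongr)⟩

end Coupling

/-! ### Comparison of the weighted costs with the unweighted cost -/

section Cost

variable {n d : ℕ} {p : ℝ}

/-- The cost `‖x - y‖_p ^ p = ∑ i, |x i - y i| ^ p`. -/
noncomputable def powDist (p : ℝ) {n : ℕ} (x y : Fin n → ℝ) : ℝ := ∑ i, |x i - y i| ^ p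

theorem powDist_nonneg (p : ℝ) (x y : Fin n → ℝ) : 0 ≤ powDist p x y :=
  Finset.sum_nonneg fun _ _ => by positivity

theorem powDist_comm (p : ℝ) (x y : Fin n → ℝ) : powDist p x y = powDist p y x := by
  simp [powDist, abs_sub_comm]

theorem powDist_self (hp : 1 ≤ p) (x : Fin n → ℝ) : powDist p x x = 0 := by
  simp [powDist, Real.zero_rpow (by linarith : p ≠ 0)]

theorem continuous_powDist (hp : 1 ≤ p) :
    Continuous fun q : (Fin n → ℝ) × (Fin n → ℝ) => powDist p q.1 q.2 := by
  unfold powDist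
  refine continuous_finsetSum _ fun i _ => Continuous.rpow_const (by fun_prop) fun _ => Or.inr ?_
  linarith

theorem continuous_powDist_right (hp : 1 ≤ p) (x : Fin n → ℝ) : Continuous (powDist p x) :=
  (continuous_powDist hp).comp (Continuous.prodMk_right x)

theorem add_rpow_le_two_rpow_mul {a b : ℝ} (ha : 0 ≤ a) (hb : 0 ≤ b) (hp : 0 ≤ p) :
    (a + b) ^ p ≤ 2 ^ p * (a ^ p + b ^ p) := by
  have hle : a + b ≤ 2 * max a b := by
    linarith [le_max_left a b, le_max_right a b]
  calc (a + b) ^ p ≤ (2 * max a b) ^ p := Real.rpow_le_rpow (by positivity) hle hp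
    _ = 2 ^ p * max a b ^ p := Real.mul_rpow (by norm_num) (by positivity)
    _ ≤ 2 ^ p * (a ^ p + b ^ p) := by
        gcongr
        have := Real.rpow_nonneg ha p
        have := Real.rpow_nonneg hb p
        rcases max_choice a b with h | h <;> rw [h] <;> linarith

theorem powDist_le (hp : 1 ≤ p) (x y z : Fin n → ℝ) :
    powDist p y z ≤ 2 ^ p * (powDist p x y + powDist p x z) := by
  unfold powDist
  rw [← Finset.sum_add_distrib, Finset.mul_sum]
  refine Finset.sum_le_sum fun i _ => ?_
  refine le_trans (Real.rpow_le_rpow (abs_nonneg _) ?_ (by linarith))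
    (add_rpow_le_two_rpow_mul (abs_nonneg _) (abs_nonneg _) (by linarith))
  rw [abs_sub_comm (x i) (y i)]
  exact abs_sub_le _ _ _

theorem lpDist_rpow (hp : 1 ≤ p) (x y : Fin n → ℝ) : lpDist p x y ^ p = powDist p x y := by
  rw [lpDist, ← powDist, ← Real.rpow_mul (powDist_nonneg p x y), one_div_mul_cancel (by linarith),
    Real.rpow_one]

theorem powDist_eq_feature_add_time (p : ℝ) (z z' : Fin (d + 1) → ℝ) :
    powDist p z z' = powDist p (feature z) (feature z') + |time z - time z'| ^ p := by
  simp [powDist, feature, time, Fin.sum_univ_castSucc]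

theorem weightedDist_rpow (hp : 1 ≤ p) {w : ℝ} (hw : w ∈ Set.Icc (0 : ℝ) 1)
    (z z' : Fin (d + 1) → ℝ) :
    weightedDist p w z z' ^ p =
      w * powDist p (feature z) (feature z') + (1 - w) * |time z - time z'| ^ p := by
  have h1 := powDist_nonneg p (feature z) (feature z')
  have h2 : 0 ≤ 1 - w := by linarith [hw.2]
  have h3 := hw.1
  rw [weightedDist, lpDist_rpow hp, ← Real.rpow_mul (by positivity),
    one_div_mul_cancel (by linarith), Real.rpow_one]

theorem weightedDist_rpow_le (hp : 1 ≤ p) {w : ℝ} (hw : w ∈ Set.Icc (0 : ℝ) 1)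
    (z z' : Fin (d + 1) → ℝ) : weightedDist p w z z' ^ p ≤ powDist p z z' := by
  rw [weightedDist_rpow hp hw, powDist_eq_feature_add_time]
  refine add_le_add (mul_le_of_le_one_left (powDist_nonneg _ _ _) hw.2)
    (mul_le_of_le_one_left (by positivity) (by linarith [hw.1]))

theorem weightedDist_half_rpow (hp : 1 ≤ p) (z z' : Fin (d + 1) → ℝ) :
    weightedDist p (1 / 2) z z' ^ p = 2⁻¹ * powDist p z z' := by
  rw [weightedDist_rpow hp (by norm_num), powDist_eq_feature_add_time]
  ring

theorem ofReal_abs_rpow (hp : 1 ≤ p) (x : ℝ) : ENNReal.ofReal (|x| ^ p) = ‖x‖ₑ ^ p := by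
  rw [← ENNReal.ofReal_rpow_of_nonneg (abs_nonneg _) (by linarith), ← Real.norm_eq_abs,
    ofReal_norm]

theorem ofReal_powDist (hp : 1 ≤ p) (x y : Fin n → ℝ) :
    ENNReal.ofReal (powDist p x y) = ∑ i, ‖x i - y i‖ₑ ^ p := by
  rw [powDist, ENNReal.ofReal_sum_of_nonneg fun _ _ => by positivity]
  simp_rw [ofReal_abs_rpow hp]

/-- Here `dist` is the sup distance, which the `ℓ^p` distance dominates. This lets the cost control
functions that are Lipschitz for the sup distance. -/
theorem enorm_dist_rpow_le (hp : 1 ≤ p) (x y : Fin n → ℝ) :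
    ‖dist x y‖ₑ ^ p ≤ ENNReal.ofReal (powDist p x y) := by
  rw [← ofReal_abs_rpow hp, abs_of_nonneg dist_nonneg]
  refine ENNReal.ofReal_le_ofReal ?_
  have h : dist x y ≤ powDist p x y ^ (1 / p) := by
    refine (dist_pi_le_iff (Real.rpow_nonneg (powDist_nonneg _ _ _) _)).2 fun i => ?_
    have hi : |x i - y i| ^ p ≤ powDist p x y :=
      Finset.single_le_sum (f := fun i => |x i - y i| ^ p) (fun _ _ => by positivity)
        (Finset.mem_univ i)
    have := Real.rpow_le_rpow (by positivity) hi (by positivity : 0 ≤ 1 / p)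
    rwa [← Real.rpow_mul (abs_nonneg _), mul_one_div_cancel (by linarith), Real.rpow_one] at this
  have := Real.rpow_le_rpow dist_nonneg h (by linarith : 0 ≤ p)
  rwa [← Real.rpow_mul (powDist_nonneg _ _ _), one_div_mul_cancel (by linarith),
    Real.rpow_one] at this

theorem mem_finiteMoment_iff (hp : 1 ≤ p) {μ : ProbabilityMeasure (Fin n → ℝ)} :
    μ ∈ FiniteMoment p n ↔
      ∀ z₀, ∫⁻ z, ENNReal.ofReal (powDist p z₀ z) ∂(μ : Measure (Fin n → ℝ)) < ∞ := by
  simp only [FiniteMoment, Set.mem_ofPred_eq, lpDist_rpow hp]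

theorem mem_couplings_iff {α β : ProbabilityMeasure (Fin n → ℝ)}
    {π : ProbabilityMeasure ((Fin n → ℝ) × (Fin n → ℝ))} :
    π ∈ Couplings α β ↔
      (π : Measure ((Fin n → ℝ) × (Fin n → ℝ))).map Prod.fst = α ∧
      (π : Measure ((Fin n → ℝ) × (Fin n → ℝ))).map Prod.snd = β := by
  refine and_congr ⟨fun h => Measure.ext fun A hA => ?_, fun h A hA => ?_⟩
    ⟨fun h => Measure.ext fun A hA => ?_, fun h A hA => ?_⟩
  · rw [Measure.map_apply measurable_fst hA, ← h A hA, Set.prod_univ]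
  · rw [← h, Measure.map_apply measurable_fst hA, Set.prod_univ]
  · rw [Measure.map_apply measurable_snd hA, ← h A hA, Set.univ_prod]
  · rw [← h, Measure.map_apply measurable_snd hA, Set.univ_prod]

theorem couplings_nonempty (α β : ProbabilityMeasure (Fin n → ℝ)) : (Couplings α β).Nonempty :=
  ⟨⟨(α : Measure (Fin n → ℝ)).prod β, inferInstance⟩, mem_couplings_iff.2 (by simp)⟩

/-- The optimal transport cost for the cost function `‖x - y‖_p ^ p`. -/
noncomputable def transportCost (p : ℝ) {n : ℕ} (α β : ProbabilityMeasure (Fin n → ℝ)) : ℝ≥0∞ :=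
  ⨅ π ∈ Couplings α β, ∫⁻ q, ENNReal.ofReal (powDist p q.1 q.2)
    ∂(π : Measure ((Fin n → ℝ) × (Fin n → ℝ)))

theorem tiotDist_le (hp : 1 ≤ p) (α β : ProbabilityMeasure (Fin (d + 1) → ℝ)) :
    tiotDist p α β ≤ transportCost p α β ^ (1 / p) := by
  refine iSup₂_le fun w hw => ENNReal.rpow_le_rpow ?_ (by positivity)
  exact iInf₂_mono fun π _ => lintegral_mono fun q =>
    ENNReal.ofReal_le_ofReal (weightedDist_rpow_le hp hw _ _)

/-- The single weight `1/2` suffices, since it treats features and time alike. -/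
theorem transportCost_le (hp : 1 ≤ p) (α β : ProbabilityMeasure (Fin (d + 1) → ℝ)) :
    transportCost p α β ≤ 2 * tiotDist p α β ^ p := by
  have h1 : weightedWasserstein p (1 / 2) α β ≤ tiotDist p α β :=
    le_iSup₂_of_le (1 / 2) (by norm_num) le_rfl
  have h2 : 2⁻¹ * transportCost p α β ≤ weightedWasserstein p (1 / 2) α β ^ p := by
    rw [weightedWasserstein, ← ENNReal.rpow_mul, one_div_mul_cancel (by linarith),
      ENNReal.rpow_one]
    refine le_iInf₂ fun π hπ => ?_
    simp_rw [weightedDist_half_rpow hp, ENNReal.ofReal_mul (by norm_num : (0 : ℝ) ≤ 2⁻¹)]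
    rw [lintegral_const_mul' _ _ ENNReal.ofReal_ne_top, ENNReal.ofReal_inv_of_pos (by norm_num),
      ENNReal.ofReal_ofNat]
    gcongr
    exact iInf₂_le π hπ
  calc transportCost p α β = 2 * (2⁻¹ * transportCost p α β) := by
        rw [← mul_assoc, ENNReal.mul_inv_cancel (by norm_num) (by norm_num), one_mul]
    _ ≤ 2 * tiotDist p α β ^ p := by
        gcongr
        exact h2.trans (ENNReal.rpow_le_rpow h1 (by linarith))

theorem tendsto_tiotDist_iff (hp : 1 ≤ p) {μs : ℕ → ProbabilityMeasure (Fin (d + 1) → ℝ)}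
    {μ : ProbabilityMeasure (Fin (d + 1) → ℝ)} :
    Tendsto (fun k => tiotDist p (μs k) μ) atTop (𝓝 0) ↔
      Tendsto (fun k => transportCost p (μs k) μ) atTop (𝓝 0) := by
  have hp0 : 0 < p := by linarith
  constructor <;> intro h
  · have := ENNReal.Tendsto.const_mul (a := 2) (h.ennrpow_const p) (Or.inr (by norm_num))
    rw [ENNReal.zero_rpow_of_pos hp0, mul_zero] at this
    exact tendsto_of_tendsto_of_tendsto_of_le_of_le tendsto_const_nhds this (fun _ => zero_le)
      fun k => transportCost_le hp _ _
  · have := h.ennrpow_const (1 / p)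
    rw [ENNReal.zero_rpow_of_pos (by positivity)] at this
    exact tendsto_of_tendsto_of_tendsto_of_le_of_le tendsto_const_nhds this (fun _ => zero_le)
      fun k => tiotDist_le hp _ _

/-- Couplings that are optimal up to `1/k` serve, so no minimizer is needed; at `k = 0` the slack is
`∞`. -/
theorem exists_couplings_tendsto {μs : ℕ → ProbabilityMeasure (Fin n → ℝ)}
    {μ : ProbabilityMeasure (Fin n → ℝ)}
    (h : Tendsto (fun k => transportCost p (μs k) μ) atTop (𝓝 0)) :
    ∃ πs : ℕ → ProbabilityMeasure ((Fin n → ℝ) × (Fin n → ℝ)),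
      (∀ k, πs k ∈ Couplings (μs k) μ) ∧
      Tendsto (fun k => ∫⁻ q, ENNReal.ofReal (powDist p q.1 q.2)
        ∂(πs k : Measure ((Fin n → ℝ) × (Fin n → ℝ)))) atTop (𝓝 0) := by
  have hex : ∀ k : ℕ, ∃ π ∈ Couplings (μs k) μ, ∫⁻ q, ENNReal.ofReal (powDist p q.1 q.2)
      ∂(π : Measure ((Fin n → ℝ) × (Fin n → ℝ))) ≤ transportCost p (μs k) μ + (k : ℝ≥0∞)⁻¹ := by
    intro k
    rcases eq_or_ne (transportCost p (μs k) μ) ∞ with ht | ht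
    · obtain ⟨π, hπ⟩ := couplings_nonempty (μs k) μ
      exact ⟨π, hπ, by simp [ht]⟩
    · have hlt : transportCost p (μs k) μ < transportCost p (μs k) μ + (k : ℝ≥0∞)⁻¹ :=
        ENNReal.lt_add_right ht (by simp)
      conv_lhs at hlt => rw [transportCost]
      obtain ⟨π, hlt⟩ := iInf_lt_iff.1 hlt
      obtain ⟨hπ, hlt⟩ := iInf_lt_iff.1 hlt
      exact ⟨π, hπ, hlt.le⟩
  choose πs hπ hle using hex
  refine ⟨πs, hπ, tendsto_of_tendsto_of_tendsto_of_le_of_le tendsto_const_nhds ?_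
    (fun _ => zero_le) hle⟩
  simpa using h.add ENNReal.tendsto_inv_nat_nhds_zero

end Cost

/-! ### Vanishing cost implies convergence in `P_p` -/

section Converse

variable {n : ℕ} {p : ℝ} {α β : ProbabilityMeasure (Fin n → ℝ)}
  {π : ProbabilityMeasure ((Fin n → ℝ) × (Fin n → ℝ))}

theorem lintegral_fst_of_mem_couplings (hπ : π ∈ Couplings α β) {g : (Fin n → ℝ) → ℝ≥0∞}
    (hg : Measurable g) :
    ∫⁻ q, g q.1 ∂(π : Measure ((Fin n → ℝ) × (Fin n → ℝ))) = ∫⁻ z, g z ∂(α : Measure _) := by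
  rw [← (mem_couplings_iff.1 hπ).1, lintegral_map hg measurable_fst]

theorem lintegral_snd_of_mem_couplings (hπ : π ∈ Couplings α β) {g : (Fin n → ℝ) → ℝ≥0∞}
    (hg : Measurable g) :
    ∫⁻ q, g q.2 ∂(π : Measure ((Fin n → ℝ) × (Fin n → ℝ))) = ∫⁻ z, g z ∂(β : Measure _) := by
  rw [← (mem_couplings_iff.1 hπ).2, lintegral_map hg measurable_snd]

theorem mem_finiteMoment_of_coupling (hp : 1 ≤ p) (hπ : π ∈ Couplings α β)
    (hα : α ∈ FiniteMoment p n)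
    (hfin : ∫⁻ q, ENNReal.ofReal (powDist p q.1 q.2)
      ∂(π : Measure ((Fin n → ℝ) × (Fin n → ℝ))) < ∞) : β ∈ FiniteMoment p n := by
  rw [mem_finiteMoment_iff hp] at hα ⊢
  intro z₀
  have hm : Measurable fun z => ENNReal.ofReal (powDist p z₀ z) :=
    (continuous_powDist_right hp z₀).measurable.ennreal_ofReal
  rw [← lintegral_snd_of_mem_couplings hπ hm]
  have hle : ∀ q : (Fin n → ℝ) × (Fin n → ℝ), ENNReal.ofReal (powDist p z₀ q.2) ≤
      ENNReal.ofReal (2 ^ p) * (ENNReal.ofReal (powDist p z₀ q.1) +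
        ENNReal.ofReal (powDist p q.1 q.2)) := fun q => by
    rw [← ENNReal.ofReal_add (powDist_nonneg _ _ _) (powDist_nonneg _ _ _),
      ← ENNReal.ofReal_mul (by positivity), powDist_comm p z₀ q.1]
    exact ENNReal.ofReal_le_ofReal (powDist_le hp _ _ _)
  refine (lintegral_mono hle).trans_lt ?_
  rw [lintegral_const_mul' _ _ ENNReal.ofReal_ne_top, lintegral_add_left (hm.fun_comp measurable_fst),
    lintegral_fst_of_mem_couplings hπ hm]
  exact ENNReal.mul_lt_top ENNReal.ofReal_lt_top (ENNReal.add_lt_top.2 ⟨hα z₀, hfin⟩)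

/-- The Lipschitz bound gives the first moment of the distance under `π`, and monotonicity of `L^p`
norms on a probability space passes to the `p`-th. Boundedness only provides integrability. -/
theorem edist_integral_le_of_coupling (hp : 1 ≤ p) (hπ : π ∈ Couplings α β)
    {f : (Fin n → ℝ) → ℝ} {C : ℝ} (hC : ∀ x y, dist (f x) (f y) ≤ C) {L : NNReal}
    (hL : LipschitzWith L f) :
    edist (∫ z, f z ∂(α : Measure (Fin n → ℝ))) (∫ z, f z ∂(β : Measure (Fin n → ℝ))) ≤
      L * (∫⁻ q, ENNReal.ofReal (powDist p q.1 q.2)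
        ∂(π : Measure ((Fin n → ℝ) × (Fin n → ℝ)))) ^ (1 / p) := by
  have hfm : Measurable f := hL.continuous.measurable
  have hb : ∀ x, ‖f x‖ ≤ C + ‖f 0‖ := fun x => by
    have h1 := hC x 0
    rw [Real.dist_eq, ← Real.norm_eq_abs] at h1
    linarith [norm_sub_norm_le (f x) (f 0)]
  have i1 : Integrable (fun q : (Fin n → ℝ) × (Fin n → ℝ) => f q.1) (π : Measure _) :=
    Integrable.of_bound (hfm.comp measurable_fst).aestronglyMeasurable _ (ae_of_all _ fun q => hb _)
  have i2 : Integrable (fun q : (Fin n → ℝ) × (Fin n → ℝ) => f q.2) (π : Measure _) :=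
    Integrable.of_bound (hfm.comp measurable_snd).aestronglyMeasurable _ (ae_of_all _ fun q => hb _)
  rw [← (mem_couplings_iff.1 hπ).1, ← (mem_couplings_iff.1 hπ).2,
    integral_map measurable_fst.aemeasurable hfm.aestronglyMeasurable,
    integral_map measurable_snd.aemeasurable hfm.aestronglyMeasurable, edist_eq_enorm_sub,
    ← integral_sub i1 i2]
  have hdist : Measurable fun q : (Fin n → ℝ) × (Fin n → ℝ) => dist q.1 q.2 := by fun_prop
  have hmono := eLpNorm'_le_eLpNorm'_of_exponent_le zero_lt_one hp (π : Measure _)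
    hdist.aestronglyMeasurable
  simp only [eLpNorm', ENNReal.rpow_one, div_one] at hmono
  calc ‖∫ q, (f q.1 - f q.2) ∂(π : Measure ((Fin n → ℝ) × (Fin n → ℝ)))‖ₑ
      ≤ ∫⁻ q, ‖f q.1 - f q.2‖ₑ ∂(π : Measure ((Fin n → ℝ) × (Fin n → ℝ))) :=
        enorm_integral_le_lintegral_enorm _
    _ ≤ ∫⁻ q, L * ‖dist q.1 q.2‖ₑ ∂(π : Measure ((Fin n → ℝ) × (Fin n → ℝ))) := by
        refine lintegral_mono fun q => ?_
        rw [← edist_eq_enorm_sub, ← ofReal_norm, Real.norm_of_nonneg dist_nonneg,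
          ← edist_dist]
        exact hL q.1 q.2
    _ = L * ∫⁻ q, ‖dist q.1 q.2‖ₑ ∂(π : Measure ((Fin n → ℝ) × (Fin n → ℝ))) :=
        lintegral_const_mul _ (by fun_prop)
    _ ≤ _ := by
        gcongr
        refine hmono.trans (ENNReal.rpow_le_rpow ?_ (by positivity))
        exact lintegral_mono fun q => enorm_dist_rpow_le hp _ _

theorem lintegral_rpow_le_add {Ω : Type*} [MeasurableSpace Ω] {ν : Measure Ω} (hp : 1 ≤ p)
    {u v : Ω → ℝ} (hu : Measurable u) (hv : Measurable v) :
    (∫⁻ ω, ‖u ω‖ₑ ^ p ∂ν) ^ (1 / p) ≤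
      (∫⁻ ω, ‖v ω‖ₑ ^ p ∂ν) ^ (1 / p) + (∫⁻ ω, ‖u ω - v ω‖ₑ ^ p ∂ν) ^ (1 / p) := by
  refine le_trans (ENNReal.rpow_le_rpow (lintegral_mono fun ω => ?_) (by positivity))
    (ENNReal.lintegral_Lp_add_le hv.enorm.aemeasurable (hu.sub hv).enorm.aemeasurable hp)
  refine ENNReal.rpow_le_rpow ?_ (by linarith)
  calc ‖u ω‖ₑ = ‖v ω + (u ω - v ω)‖ₑ := by rw [add_sub_cancel]
    _ ≤ _ := enorm_add_le _ _

/-- Under a coupling, Minkowski's inequality in both directions shows that the `L^p` norms of a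
coordinate differ by at most the `p`-th root of the cost. -/
theorem tendsto_lintegral_coordinate (hp : 1 ≤ p) {μs : ℕ → ProbabilityMeasure (Fin n → ℝ)}
    {μ : ProbabilityMeasure (Fin n → ℝ)}
    {πs : ℕ → ProbabilityMeasure ((Fin n → ℝ) × (Fin n → ℝ))}
    (hπ : ∀ k, πs k ∈ Couplings (μs k) μ)
    (hlim : Tendsto (fun k => ∫⁻ q, ENNReal.ofReal (powDist p q.1 q.2)
        ∂(πs k : Measure ((Fin n → ℝ) × (Fin n → ℝ)))) atTop (𝓝 0))
    (hμ : μ ∈ FiniteMoment p n) (z₀ : Fin n → ℝ) (i : Fin n) :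
    Tendsto (fun k => ∫⁻ z, ‖z₀ i - z i‖ₑ ^ p ∂(μs k : Measure (Fin n → ℝ))) atTop
      (𝓝 (∫⁻ z, ‖z₀ i - z i‖ₑ ^ p ∂(μ : Measure (Fin n → ℝ)))) := by
  have hp0 : p ≠ 0 := by linarith
  have hle : ∀ x y : Fin n → ℝ, ‖x i - y i‖ₑ ^ p ≤ ENNReal.ofReal (powDist p x y) := fun x y => by
    rw [ofReal_powDist hp]
    exact Finset.single_le_sum (f := fun i => ‖x i - y i‖ₑ ^ p) (fun _ _ => zero_le)
      (Finset.mem_univ i)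
  have hm : Measurable fun z : Fin n → ℝ => ‖z₀ i - z i‖ₑ ^ p := by fun_prop
  have hfin : ∫⁻ z, ‖z₀ i - z i‖ₑ ^ p ∂(μ : Measure (Fin n → ℝ)) ≠ ∞ :=
    ((lintegral_mono fun z => hle z₀ z).trans_lt ((mem_finiteMoment_iff hp).1 hμ z₀)).ne
  set e : ℕ → ℝ≥0∞ := fun k => (∫⁻ q, ENNReal.ofReal (powDist p q.1 q.2)
    ∂(πs k : Measure ((Fin n → ℝ) × (Fin n → ℝ)))) ^ (1 / p)
  have he : Tendsto e atTop (𝓝 0) := by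
    have := hlim.ennrpow_const (1 / p)
    rwa [ENNReal.zero_rpow_of_pos (by positivity)] at this
  set A : ProbabilityMeasure (Fin n → ℝ) → ℝ≥0∞ :=
    fun ν => (∫⁻ z, ‖z₀ i - z i‖ₑ ^ p ∂(ν : Measure (Fin n → ℝ))) ^ (1 / p)
  have hA : A μ ≠ ∞ := ENNReal.rpow_ne_top_of_nonneg (by positivity) hfin
  have h1 : ∀ k, A (μs k) ≤ A μ + e k := fun k => by
    simp only [A, ← lintegral_fst_of_mem_couplings (hπ k) hm,
      ← lintegral_snd_of_mem_couplings (hπ k) hm]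
    refine (lintegral_rpow_le_add hp (v := fun q => z₀ i - q.2 i) (by fun_prop)
      (by fun_prop)).trans ?_
    gcongr
    refine ENNReal.rpow_le_rpow (lintegral_mono fun q => ?_) (by positivity)
    rw [sub_sub_sub_cancel_left, powDist_comm]
    exact hle _ _
  have h2 : ∀ k, A μ ≤ A (μs k) + e k := fun k => by
    simp only [A, ← lintegral_fst_of_mem_couplings (hπ k) hm,
      ← lintegral_snd_of_mem_couplings (hπ k) hm]
    refine (lintegral_rpow_le_add hp (v := fun q => z₀ i - q.1 i) (by fun_prop)
      (by fun_prop)).trans ?_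
    gcongr
    refine ENNReal.rpow_le_rpow (lintegral_mono fun q => ?_) (by positivity)
    rw [sub_sub_sub_cancel_left]
    exact hle _ _
  have hlo : Tendsto (fun k => A μ - e k) atTop (𝓝 (A μ)) := by
    simpa using ENNReal.Tendsto.sub (tendsto_const_nhds (x := A μ)) he (Or.inl hA)
  have hhi : Tendsto (fun k => A μ + e k) atTop (𝓝 (A μ)) := by
    simpa using (tendsto_const_nhds (x := A μ)).add he
  have hlimA : Tendsto (fun k => A (μs k)) atTop (𝓝 (A μ)) :=
    tendsto_of_tendsto_of_tendsto_of_le_of_le hlo hhi (fun k => tsub_le_iff_right.2 (h2 k)) h1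
  have := hlimA.ennrpow_const p
  simpa only [A, ← ENNReal.rpow_mul, one_div_mul_cancel hp0, ENNReal.rpow_one] using this

theorem integral_lpDist_rpow (hp : 1 ≤ p) (μ : ProbabilityMeasure (Fin n → ℝ)) (z₀ : Fin n → ℝ) :
    ∫ z, lpDist p z₀ z ^ p ∂(μ : Measure (Fin n → ℝ)) =
      (∫⁻ z, ENNReal.ofReal (powDist p z₀ z) ∂(μ : Measure (Fin n → ℝ))).toReal := by
  simp_rw [lpDist_rpow hp]
  exact integral_eq_lintegral_of_nonneg_ae (ae_of_all _ fun z => powDist_nonneg _ _ _)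
    (continuous_powDist_right hp z₀).aestronglyMeasurable

theorem weaklyConvergesInPp_of_tendsto_transportCost (hp : 1 ≤ p)
    {μs : ℕ → ProbabilityMeasure (Fin n → ℝ)} (hμs : ∀ k, μs k ∈ FiniteMoment p n)
    {μ : ProbabilityMeasure (Fin n → ℝ)}
    (h : Tendsto (fun k => transportCost p (μs k) μ) atTop (𝓝 0)) :
    WeaklyConvergesInPp p μs μ := by
  obtain ⟨πs, hπ, hlim⟩ := exists_couplings_tendsto h
  have hμ : μ ∈ FiniteMoment p n := by
    -- One coupling of finite cost carries the finite moment of `μs k` over to `μ`.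
    obtain ⟨k, hk⟩ := (hlim.eventually_lt_const ENNReal.zero_lt_top).exists
    exact mem_finiteMoment_of_coupling hp (hπ k) (hμs k) hk
  refine ⟨hμs, hμ, ?_, fun z₀ => ?_⟩
  · refine ProbabilityMeasure.tendsto_iff_forall_integral_tendsto.1 ?_
    refine tendsto_iff_forall_lipschitz_integral_tendsto.2 ?_
    rintro f ⟨C, hC⟩ ⟨L, hL⟩
    rw [tendsto_iff_edist_tendsto_0]
    have hL0 := ENNReal.Tendsto.const_mul (a := (L : ℝ≥0∞)) (hlim.ennrpow_const (1 / p))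
      (Or.inr ENNReal.coe_ne_top)
    rw [ENNReal.zero_rpow_of_pos (by positivity), mul_zero] at hL0
    exact tendsto_of_tendsto_of_tendsto_of_le_of_le tendsto_const_nhds hL0 (fun _ => zero_le)
      fun k => edist_integral_le_of_coupling hp (hπ k) hC hL
  · simp_rw [integral_lpDist_rpow hp]
    refine (ENNReal.tendsto_toReal ((mem_finiteMoment_iff hp).1 hμ z₀).ne).comp ?_
    simp_rw [ofReal_powDist hp]
    have hs : ∀ ν : ProbabilityMeasure (Fin n → ℝ),
        ∫⁻ z, ∑ i, ‖z₀ i - z i‖ₑ ^ p ∂(ν : Measure (Fin n → ℝ)) =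
          ∑ i, ∫⁻ z, ‖z₀ i - z i‖ₑ ^ p ∂(ν : Measure (Fin n → ℝ)) := fun ν =>
      lintegral_finsetSum _ fun i _ => by fun_prop
    simp_rw [hs]
    exact tendsto_finsetSum _ fun i _ => tendsto_lintegral_coordinate hp hπ hlim hμ z₀ i

end Converse

/-! ### Convergence in `P_p` implies vanishing cost -/

section Direct

variable {n : ℕ} {p : ℝ}

/-- Compact support makes `g` bounded, so this applies even to a partition function times the
unbounded moment weight. -/
theorem tendsto_lintegral_ofReal_of_hasCompactSupport
    {μs : ℕ → ProbabilityMeasure (Fin n → ℝ)} {μ : ProbabilityMeasure (Fin n → ℝ)}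
    (h : Tendsto μs atTop (𝓝 μ)) {g : (Fin n → ℝ) → ℝ} (hg : Continuous g)
    (hc : HasCompactSupport g) :
    Tendsto (fun k => ∫⁻ z, ENNReal.ofReal (g z) ∂(μs k : Measure (Fin n → ℝ))) atTop
      (𝓝 (∫⁻ z, ENNReal.ofReal (g z) ∂(μ : Measure (Fin n → ℝ)))) := by
  obtain ⟨C, hC⟩ := hc.exists_bound_of_continuous hg
  exact ProbabilityMeasure.tendsto_iff_forall_lintegral_tendsto.1 h
    (BoundedContinuousFunction.ofNormedAddCommGroup g hg C hC).nnrealPart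

theorem tendsto_transportCost_of_weaklyConvergesInPp (hp : 1 ≤ p)
    {μs : ℕ → ProbabilityMeasure (Fin n → ℝ)} {μ : ProbabilityMeasure (Fin n → ℝ)}
    (h : WeaklyConvergesInPp p μs μ) :
    Tendsto (fun k => transportCost p (μs k) μ) atTop (𝓝 0) := by
  have hweak : Tendsto μs atTop (𝓝 μ) :=
    ProbabilityMeasure.tendsto_iff_forall_integral_tendsto.2 h.tendsto_integral
  have hfin := fun k => (mem_finiteMoment_iff hp).1 (h.mem_seq k) 0
  have hfinμ := (mem_finiteMoment_iff hp).1 h.mem_limit 0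
  set N : (Fin n → ℝ) → ℝ≥0∞ := fun z => ENNReal.ofReal (powDist p 0 z)
  have hNc : Continuous (powDist p (0 : Fin n → ℝ)) := continuous_powDist_right hp 0
  have hN : Measurable N := hNc.measurable.ennreal_ofReal
  have hmoment : Tendsto (fun k => ∫⁻ z, N z ∂(μs k : Measure (Fin n → ℝ))) atTop
      (𝓝 (∫⁻ z, N z ∂(μ : Measure (Fin n → ℝ)))) := by
    have := h.tendsto_moment 0
    simp_rw [integral_lpDist_rpow hp] at this
    exact (ENNReal.tendsto_toReal_iff (fun k => (hfin k).ne) hfinμ.ne).1 this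
  rw [ENNReal.tendsto_nhds_zero]
  intro ε hε
  obtain ⟨e, he0, heε⟩ := ENNReal.lt_iff_exists_nnreal_btwn.1 hε
  have he : (0 : ℝ) < e := by exact_mod_cast he0
  -- The matched and the leftover mass each cost at most `2 ^ p * (t + t) = e / 2`.
  set t : ℝ := e / (4 * 2 ^ p) with ht_def
  have ht : 0 < t := by positivity
  have : IsFiniteMeasure ((μ : Measure (Fin n → ℝ)).withDensity N) :=
    isFiniteMeasure_withDensity hfinμ.ne
  -- Inner regularity is applied to the measure with density `N`, so that the moment outside `K`,
  -- and not just the mass, is small.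
  obtain ⟨K, -, hK, hKlt⟩ := MeasurableSet.univ.exists_isCompact_sdiff_lt
    (μ := (μ : Measure (Fin n → ℝ)).withDensity N) (measure_ne_top _ _)
    (ENNReal.ofReal_pos.2 ht).ne'
  obtain ⟨T, hT⟩ := hK.elim_finite_subcover (fun x => {z | powDist p x z < t})
    (fun x => isOpen_lt (continuous_powDist_right hp x) continuous_const)
    (fun x _ => Set.mem_iUnion.2 ⟨x, by simpa [powDist_self hp] using ht⟩)
  obtain ⟨g, hgU, hgc⟩ := PartitionOfUnity.exists_isSubordinate_of_locallyFinite_t2space hK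
    (fun x : T => {z | powDist p x z < t})
    (fun x => isOpen_lt (continuous_powDist_right hp x.1) continuous_const)
    (locallyFinite_of_finite _)
    (fun z hz => by simpa using hT hz)
  set f : T → (Fin n → ℝ) → ℝ≥0∞ := fun i z => ENNReal.ofReal (g i z)
  have hf : ∀ i, Measurable (f i) := fun i => (g i).continuous.measurable.ennreal_ofReal
  have hfsum : ∀ z, ∑ i, f i z = ENNReal.ofReal (∑ᶠ i, g i z) := fun z => by
    rw [finsum_eq_sum_of_fintype, ENNReal.ofReal_sum_of_nonneg fun i _ => g.nonneg i z]
  have hsum : ∀ z, ∑ i, f i z ≤ 1 := fun z => by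
    rw [hfsum, ENNReal.ofReal_le_one]
    exact g.sum_le_one z
  have hδ : ∀ i z z', f i z ≠ 0 → f i z' ≠ 0 →
      ENNReal.ofReal (powDist p z z') ≤ ENNReal.ofReal (e / 2) := by
    intro i z z' hz hz'
    have hsupp : ∀ y, f i y ≠ 0 → powDist p i y < t := fun y hy =>
      hgU i (subset_tsupport _ fun h0 => hy (by simp [f, h0]))
    refine ENNReal.ofReal_le_ofReal ?_
    calc powDist p z z' ≤ 2 ^ p * (powDist p i z + powDist p i z') := powDist_le hp _ _ _
      _ ≤ 2 ^ p * (t + t) := by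
          gcongr
          exacts [(hsupp z hz).le, (hsupp z' hz').le]
      _ = e / 2 := by rw [ht_def]; field_simp; ring
  have hC : ∀ z z', ENNReal.ofReal (powDist p z z') ≤
      ENNReal.ofReal (2 ^ p) * (N z + N z') := fun z z' => by
    rw [← ENNReal.ofReal_add (powDist_nonneg _ _ _) (powDist_nonneg _ _ _),
      ← ENNReal.ofReal_mul (by positivity)]
    exact ENNReal.ofReal_le_ofReal (powDist_le hp _ _ _)
  have hi : ∀ i, Tendsto (fun k => ∫⁻ z, f i z ∂(μs k : Measure (Fin n → ℝ))) atTop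
      (𝓝 (∫⁻ z, f i z ∂(μ : Measure (Fin n → ℝ)))) := fun i =>
    tendsto_lintegral_ofReal_of_hasCompactSupport hweak (g i).continuous (hgc i)
  have hiN : ∀ i, Tendsto (fun k => ∫⁻ z, f i z * N z ∂(μs k : Measure (Fin n → ℝ))) atTop
      (𝓝 (∫⁻ z, f i z * N z ∂(μ : Measure (Fin n → ℝ)))) := fun i => by
    simp only [f, N, ← ENNReal.ofReal_mul (g.nonneg i _)]
    exact tendsto_lintegral_ofReal_of_hasCompactSupport hweak ((g i).continuous.mul hNc)
      (hgc i).mul_right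
  -- The residual vanishes on `K`, where the partition sums to one, and is at most one elsewhere.
  have hη : ∫⁻ z, residual f 1 z * N z ∂(μ : Measure (Fin n → ℝ)) < ENNReal.ofReal t := by
    refine lt_of_le_of_lt ?_ hKlt
    rw [withDensity_apply _ (MeasurableSet.univ.diff hK.measurableSet), ← Set.compl_eq_univ_sdiff,
      ← lintegral_indicator hK.measurableSet.compl]
    refine lintegral_mono fun z => ?_
    by_cases hz : z ∈ K
    · have h0 : residual f 1 z = 0 := by
        simp only [residual, Pi.one_apply, one_mul]
        rw [hfsum, g.sum_eq_one hz, ENNReal.ofReal_one, tsub_self]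
      rw [h0, zero_mul]
      exact zero_le
    · rw [Set.indicator_of_mem hz]
      exact mul_le_of_le_one_left' tsub_le_self
  filter_upwards [eventually_exists_coupling_lintegral_le hf hsum hN
    (c := fun q => ENNReal.ofReal (powDist p q.1 q.2)) hδ hC
    (ν := fun k => (μs k : Measure (Fin n → ℝ))) hfinμ.ne hmoment hi hiN hη]
    with k ⟨π, hπ1, hπ2, hπ⟩
  have : IsProbabilityMeasure π := ⟨by
    rw [← Set.preimage_univ (f := Prod.fst), ← Measure.map_apply measurable_fst MeasurableSet.univ,
      hπ1, measure_univ]⟩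
  refine (iInf₂_le (⟨π, this⟩ : ProbabilityMeasure _) (mem_couplings_iff.2 ⟨hπ1, hπ2⟩)).trans ?_
  refine hπ.trans (le_trans (le_of_eq ?_) heε.le)
  rw [← ENNReal.ofReal_add ht.le ht.le, ← ENNReal.ofReal_mul (by positivity),
    ← ENNReal.ofReal_add (by positivity) (by positivity), ← ENNReal.ofReal_coe_nnreal]
  congr 1
  rw [ht_def]
  field_simp
  ring

end Direct

end TiOT

theorem mainTheorem3 (p : ℝ) (hp : 1 ≤ p) (d : ℕ)
    (μs : ℕ → ProbabilityMeasure (Fin (d + 1) → ℝ))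
    (hμs : ∀ k, μs k ∈ TiOT.FiniteMoment p (d + 1))
    (μ : ProbabilityMeasure (Fin (d + 1) → ℝ)) :
    TiOT.WeaklyConvergesInPp p μs μ ↔
      Tendsto (fun k => TiOT.tiotDist p (μs k) μ) atTop (𝓝 0) := by
  rw [TiOT.tendsto_tiotDist_iff hp]
  exact ⟨TiOT.tendsto_transportCost_of_weaklyConvergesInPp hp,
    TiOT.weaklyConvergesInPp_of_tendsto_transportCost hp hμs⟩
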